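/- For an integer $k\ge 1$ let $E_k=\prod_{m\ge 1}(1-q^{km})$, and let $p_{9,3}(n)$ be defined by $$\sum_{n\ge 0}p_{9,3}(n)\,q^n=\frac{1}{E_1^3E_9^3}.$$ Then for all integers $n\ge 0$ and $\alpha\ge 1$, $$p_{9,3}\left(3^{2\alpha-1}n+\frac{3^{2\alpha-1}+5}{4}\right)\equiv 0\pmod{3^{2\alpha}},$$ $$p_{9,3}\left(3^{2\alpha+1}n+\frac{7\cdot 3^{2\alpha}+5}{4}\right)\equiv 0\pmod{3^{2\alpha+4}},$$ $$p_{9,3}\left(3^{2\alpha+1}n+\frac{11\cdot 3^{2\alpha}+5}{4}\right)\equiv 0\pmod{3^{2\alpha+5}},$$ $$p_{9,3}\left(3^{2\alpha}n+\frac{5\cdot 3^{2\alpha-1}+5}{4}\right)\equiv 0\pmod{3^{2\alpha+1}},$$ $$p_{9,3}\left(3^{2\alpha}n+\frac{3^{2\alpha+1}+5}{4}\right)\equiv 0\pmod{3^{2\alpha+2}}.$$ -/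

import Mathlib

open scoped PowerSeries.WithPiTopology

/-- The Euler product `E_k = (q^k; q^k)_∞ = ∏_{n ≥ 1} (1 - q^{k n})` as a formal power series in
`q = X` with integer coefficients (the infinite product converges coefficientwise for `k ≥ 1`, see
`multipliable_eulerE`). -/
noncomputable def eulerE (k : ℕ) : PowerSeries ℤ :=
  ∏' n : ℕ, (1 - (PowerSeries.X : PowerSeries ℤ) ^ (k * (n + 1)))

/-- The 2-color partition triple function `p_{k,3}(n)`: the coefficient of `q^n` in
`1 / (E_1^3 E_k^3)`. The inverse is the one in `ℤ⟦q⟧` of a series with constant term `1`, see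
`partitionTriple_genFun`. -/
noncomputable def partitionTriple (k n : ℕ) : ℤ :=
  PowerSeries.coeff n (PowerSeries.invOfUnit (eulerE 1 ^ 3 * eulerE k ^ 3) 1)

/-- The infinite product defining `E_k` converges for `k ≥ 1`. -/
theorem multipliable_eulerE {k : ℕ} (hk : 1 ≤ k) :
    Multipliable fun n : ℕ => (1 - (PowerSeries.X : PowerSeries ℤ) ^ (k * (n + 1))) := by
  simp_rw [sub_eq_add_neg]
  apply PowerSeries.WithPiTopology.multipliable_one_add_of_tendsto_order_atTop_nhds_top
  refine ENat.tendsto_nhds_top_iff_natCast_lt.mpr (fun m ↦ Filter.eventually_atTop.mpr ⟨m, ?_⟩)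
  intro n hn
  rw [PowerSeries.order_neg, PowerSeries.order_X_pow]
  norm_cast
  nlinarith

/-- `E_k` has constant term `1` for `k ≥ 1`. -/
theorem constantCoeff_eulerE {k : ℕ} (hk : 1 ≤ k) :
    PowerSeries.constantCoeff (eulerE k) = 1 := by
  have hk0 : k ≠ 0 := by omega
  simp [eulerE, (multipliable_eulerE hk).map_tprod _
    (PowerSeries.WithPiTopology.continuous_constantCoeff ℤ), hk0]

/-- The generating function of `p_{k,3}(n)` is `1 / (E_1^3 E_k^3)` for `k ≥ 1`. -/
theorem partitionTriple_genFun {k : ℕ} (hk : 1 ≤ k) :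
    PowerSeries.mk (partitionTriple k) * (eulerE 1 ^ 3 * eulerE k ^ 3) = 1 := by
  have h : PowerSeries.mk (partitionTriple k)
      = PowerSeries.invOfUnit (eulerE 1 ^ 3 * eulerE k ^ 3) 1 := by
    ext n
    simp [partitionTriple]
  rw [h, mul_comm]
  apply PowerSeries.mul_invOfUnit
  simp [constantCoeff_eulerE hk, constantCoeff_eulerE le_rfl]

/-! Jacobi's expansion of `E_1^3` gives the 3-dissection `E_1^3 = A - t` with `A = P(q^3)` and `t =
3 q E_9^3`. Multiplying its twists `q ↦ ζ q` over the cube roots of unity yields `A^3 - t^3 = E_3^12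
/ E_9^3` (`eulerCubePart_cube`), so `1/E_1^3` is `A^2 + A t + t^2` divided by a series in `q^3`.

Put `W = 27 q E_3^12 / E_1^12`. Up to that divisor, `t^3` and `A^3` are `W(q^3)` and `1 + W(q^3)`,
so dissecting powers of `1/E_1^3` keeps all coefficients in `ℤ[W]`. Two shapes then alternate: the
residue-2 part of `E_3^6/E_1^12 · F(W)` is 9 times some `E_3^12/E_1^18 · G(W)`, and the residue-0
part of the latter has the first shape again (`dissection_oddLevel`, `dissection_evenLevel`). Each
round trip gains `3^2`.

The remaining residues give the other congruences. At the first level, one factor `t` supplies 3. At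
the second, `t` and `t^2` supply 3 and 9, and a further 3 comes from `(A^2 + A t + t^2)^6 ≡ (A^3 -
t^3)^4 (mod 3)` together with `F(W) ∈ ℤ + 9 ℤ⟦q⟧`. -/

open PowerSeries Finset

/-! ### Gaussian binomials and a finite Jacobi identity -/

/-- The finite product `(q; q)_n = ∏_{k=1}^n (1 - q^k)`. -/
noncomputable def qPochhammer (n : ℕ) : ℤ⟦X⟧ := ∏ k ∈ range n, (1 - X ^ (k + 1))

/-- The Gaussian binomial coefficient as a formal power series in `q = X`. -/
noncomputable def qBinom : ℕ → ℕ → ℤ⟦X⟧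
  | _, 0 => 1
  | 0, _ + 1 => 0
  | n + 1, k + 1 => qBinom n k + X ^ (k + 1) * qBinom n (k + 1)

theorem qBinom_zero_right (n : ℕ) : qBinom n 0 = 1 := by
  cases n <;> simp [qBinom]

theorem qBinom_succ_succ (n k : ℕ) :
    qBinom (n + 1) (k + 1) = qBinom n k + X ^ (k + 1) * qBinom n (k + 1) := by
  rw [qBinom]

theorem qBinom_eq_zero_of_lt {n k : ℕ} (h : n < k) : qBinom n k = 0 := by
  induction n generalizing k with
  | zero => obtain ⟨k, rfl⟩ := Nat.exists_eq_succ_of_ne_zero h.ne_bot; simp [qBinom]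
  | succ n ih =>
    obtain ⟨k, rfl⟩ := Nat.exists_eq_succ_of_ne_zero h.ne_bot
    rw [Nat.succ_eq_add_one, qBinom_succ_succ, ih (by omega), ih (by omega)]
    simp

theorem qPochhammer_succ (n : ℕ) : qPochhammer (n + 1) = qPochhammer n * (1 - X ^ (n + 1)) := by
  simp [qPochhammer, prod_range_succ]

theorem constantCoeff_qPochhammer (n : ℕ) : constantCoeff (qPochhammer n) = 1 := by
  simp [qPochhammer]

theorem qPochhammer_ne_zero (n : ℕ) : qPochhammer n ≠ 0 := by
  intro h
  have := constantCoeff_qPochhammer n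
  simp [h] at this

theorem qBinom_self (n : ℕ) : qBinom n n = 1 := by
  induction n with
  | zero => exact qBinom_zero_right 0
  | succ n ih => rw [qBinom_succ_succ, ih, qBinom_eq_zero_of_lt (Nat.lt_succ_self n)]; simp

/-- The quotient formula for Gaussian binomials, cross-multiplied to avoid division; the nested
induction follows the `q`-Pascal rule. -/
theorem qBinom_add_mul_qPochhammer (i j : ℕ) :
    qBinom (i + j) j * (qPochhammer i * qPochhammer j) = qPochhammer (i + j) := by
  induction i generalizing j with
  | zero => simp [qBinom_self, qPochhammer]
  | succ i ihi =>
    induction j with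
    | zero => simp [qBinom_zero_right, qPochhammer]
    | succ j ihj =>
      have h := ihi (j + 1)
      rw [show i + 1 + (j + 1) = (i + 1 + j) + 1 by ring, qBinom_succ_succ, qPochhammer_succ (i + 1 + j)]
      rw [show i + (j + 1) = i + 1 + j by ring] at h
      rw [qPochhammer_succ] at h ihj
      rw [qPochhammer_succ, qPochhammer_succ]
      linear_combination (1 - X ^ (j + 1)) * ihj + X ^ (j + 1) * (1 - X ^ (i + 1)) * h

theorem qBinom_symm (i j : ℕ) : qBinom (i + j) i = qBinom (i + j) j := by
  have h₁ := qBinom_add_mul_qPochhammer i j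
  have h₂ := qBinom_add_mul_qPochhammer j i
  rw [add_comm j i] at h₂
  refine mul_right_cancel₀ (mul_ne_zero (qPochhammer_ne_zero i) (qPochhammer_ne_zero j)) ?_
  rw [h₁, ← h₂, mul_comm (qPochhammer i)]

/-- The `q`-binomial theorem, in homogeneous form. -/
theorem prod_add_mul_X_pow {A : Type*} [CommRing A] [Algebra ℤ⟦X⟧ A] (a b : A) (n : ℕ) :
    ∏ k ∈ range n, (b + a * algebraMap ℤ⟦X⟧ A (X ^ k)) =
      ∑ j ∈ range (n + 1), algebraMap ℤ⟦X⟧ A (X ^ (j.choose 2) * qBinom n j) *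
        (a ^ j * b ^ (n - j)) := by
  induction n generalizing a with
  | zero => simp [qBinom]
  | succ n ih =>
    have key : ∏ k ∈ range n, (b + a * algebraMap ℤ⟦X⟧ A (X ^ (k + 1))) =
      ∏ k ∈ range n, (b + (a * algebraMap ℤ⟦X⟧ A X) * algebraMap ℤ⟦X⟧ A (X ^ k)) :=
      prod_congr rfl fun k _ => by simp only [map_pow]; ring
    rw [prod_range_succ', key, ih, pow_zero, map_one, mul_one, mul_add]
    have hb : (∑ j ∈ range (n + 1), algebraMap ℤ⟦X⟧ A (X ^ (j.choose 2) * qBinom n j) *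
        ((a * algebraMap ℤ⟦X⟧ A X) ^ j * b ^ (n - j))) * b =
        ∑ j ∈ range (n + 1), algebraMap ℤ⟦X⟧ A (X ^ (j.choose 2 + (j + 1)) * qBinom n (j + 1)) *
        (algebraMap ℤ⟦X⟧ A (X ^ j) * a ^ (j + 1) * b ^ (n - j)) + b ^ (n + 1) := by
      rw [sum_range_succ', sum_range_succ _ n, qBinom_eq_zero_of_lt (Nat.lt_succ_self n), add_mul,
        sum_mul]
      simp only [mul_zero, map_zero, zero_mul, add_zero, qBinom_zero_right]
      congr 1
      · refine sum_congr rfl fun j hj => ?_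
        rw [show n - j = (n - (j + 1)) + 1 by have := mem_range.1 hj; omega,
          Nat.choose_succ_succ' j 1]
        simp only [map_mul, map_pow, Nat.choose_one_right]
        ring
      · simp [pow_succ]
    rw [hb, sum_range_succ' _ (n + 1), sum_mul, add_right_comm, ← sum_add_distrib]
    congr 1
    · refine sum_congr rfl fun j hj => ?_
      rw [qBinom_succ_succ, Nat.choose_succ_succ' j 1, Nat.add_sub_add_right]
      simp only [map_mul, map_pow, map_add, Nat.choose_one_right]
      ring
    · simp [qBinom_zero_right]

theorem two_mul_succ_choose_two (n : ℕ) : 2 * (n + 1).choose 2 = (n + 1) * n := by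
  induction n with
  | zero => rfl
  | succ n ih => rw [Nat.choose_succ_succ' (n + 1) 1, Nat.choose_one_right, mul_add, ih]; ring

theorem prod_X_pow_sub_X_pow (n : ℕ) :
    ∏ k ∈ range n, ((X : ℤ⟦X⟧) ^ n - X ^ k) = (-1) ^ n * X ^ (n.choose 2) * qPochhammer n := by
  induction n with
  | zero => simp [qPochhammer]
  | succ n ih =>
    have : ∏ k ∈ range n, ((X : ℤ⟦X⟧) ^ (n + 1) - X ^ (k + 1)) =
        ∏ k ∈ range n, X * ((X : ℤ⟦X⟧) ^ n - X ^ k) := prod_congr rfl fun k _ => by ring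
    rw [prod_range_succ', this, prod_mul_distrib, ih, qPochhammer_succ, Nat.choose_succ_succ' n 1,
      Nat.choose_one_right, prod_const, card_range]
    ring

theorem prod_X_pow_sub_X_pow_add (n : ℕ) :
    ∏ k ∈ range n, ((X : ℤ⟦X⟧) ^ n - X ^ (n + 1 + k)) = X ^ (n * n) * qPochhammer n := by
  have : ∀ k ∈ range n, (X : ℤ⟦X⟧) ^ n - X ^ (n + 1 + k) = X ^ n * (1 - X ^ (k + 1)) :=
    fun k _ => by ring
  rw [prod_congr rfl this, prod_mul_distrib, prod_const, card_range, ← pow_mul, qPochhammer]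

/-- The derivative at `y = 1` of the `q`-binomial theorem for `∏_{k ≤ 2n} (q^n - y q^k)`. -/
theorem sum_neg_one_pow_mul_qBinom (n : ℕ) :
    ∑ j ∈ range (2 * n + 2), X ^ (j.choose 2) * qBinom (2 * n + 1) j *
        ((-1) ^ j * (j : ℤ⟦X⟧) * X ^ (n * (2 * n + 1 - j))) =
      (-1) ^ (n + 1) * X ^ (n + n.choose 2 + n * n) * qPochhammer n ^ 2 := by
  have h := prod_add_mul_X_pow (A := Polynomial ℤ⟦X⟧) (-Polynomial.X)
    (Polynomial.C ((X : ℤ⟦X⟧) ^ n)) (2 * n + 1)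
  -- This isolates the factor `k = n`, which is `q^n (1 - y)`. It vanishes at `y = 1`, so only the
  -- term differentiating it survives.
  rw [show 2 * n + 1 = (n + 1) + n by ring, prod_range_add, prod_range_succ,
    show (n + 1) + n = 2 * n + 1 by ring] at h
  replace h := congrArg (fun p => (Polynomial.derivative p).eval 1) h
  simp only [Polynomial.algebraMap_eq, Polynomial.derivative_mul, Polynomial.eval_add,
    Polynomial.eval_mul, Polynomial.derivative_sum, Polynomial.eval_finsetSum] at h
  have hR : ∀ j : ℕ, Polynomial.eval (1 : ℤ⟦X⟧) (Polynomial.derivative ((-Polynomial.X) ^ j)) =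
      (-1) ^ j * j := by
    intro j
    cases j with
    | zero => simp
    | succ j => simp [Polynomial.derivative_pow]; ring
  simp only [hR, Polynomial.derivative_C, Polynomial.eval_zero, Polynomial.eval_C, zero_mul,
    ← map_pow, mul_zero, add_zero, zero_add, Polynomial.derivative_add, Polynomial.derivative_neg,
    Polynomial.derivative_X, Polynomial.derivative_mul, Polynomial.eval_prod, Polynomial.eval_add,
    Polynomial.eval_mul, Polynomial.eval_neg, Polynomial.eval_X, Polynomial.eval_one,
    neg_mul, one_mul, ← sub_eq_add_neg, sub_self, prod_X_pow_sub_X_pow,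
    prod_X_pow_sub_X_pow_add, ← pow_mul] at h
  rw [← h]
  ring

/-- A finite form of Jacobi's identity for the cube of the Euler product. -/
theorem sum_qBinom_eq_qPochhammer_sq (n : ℕ) :
    ∑ i ∈ range (n + 1), (-1) ^ i * (2 * (i : ℤ⟦X⟧) + 1) * X ^ ((i + 1).choose 2) *
      qBinom (2 * n + 1) (n + 1 + i) = qPochhammer n ^ 2 := by
  have h := sum_neg_one_pow_mul_qBinom n
  -- Pair `j = n - i` with `j = n + 1 + i`: the binomials and the total powers of `q` agree and the
  -- signs are opposite, so the weights combine to `(n + 1 + i) - (n - i) = 2i + 1`.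
  rw [show 2 * n + 2 = (n + 1) + (n + 1) by ring, sum_range_add, ← sum_range_reflect,
    ← sum_add_distrib] at h
  refine mul_left_cancel₀ (mul_ne_zero (pow_ne_zero (n + 1) (neg_ne_zero.2 (one_ne_zero' ℤ⟦X⟧)))
    (pow_ne_zero (n + n.choose 2 + n * n) (X_ne_zero (R := ℤ)))) ?_
  rw [← h, mul_sum]
  refine sum_congr rfl fun i hi => ?_
  obtain ⟨m, rfl⟩ : ∃ m, n = m + i := ⟨n - i, by have := mem_range.1 hi; omega⟩
  have hB : qBinom (2 * (m + i) + 1) m = qBinom (2 * (m + i) + 1) (m + i + 1 + i) := by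
    have := qBinom_symm m (m + i + 1 + i)
    rwa [show m + (m + i + 1 + i) = 2 * (m + i) + 1 by ring] at this
  have e₀ : m + i + 1 - 1 - i = m := by omega
  have e₁ : 2 * (m + i) + 1 - m = m + 2 * i + 1 := by omega
  have e₂ : 2 * (m + i) + 1 - (m + i + 1 + i) = m := by omega
  have t : ∀ k : ℕ, (2 * (k.choose 2 : ℤ)) = k * (k - 1) := by
    intro k
    cases k with
    | zero => simp
    | succ k => have := two_mul_succ_choose_two k; push_cast; rw [add_sub_cancel_right]; exact_mod_cast this
  have t₁ : m.choose 2 + (m + i) * (m + 2 * i + 1) =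
      (m + i) + (m + i).choose 2 + (m + i) * (m + i) + (i + 1).choose 2 := by
    have h₁ := t m
    have h₂ := t (m + i)
    have h₃ := t (i + 1)
    zify
    push_cast at h₁ h₂ h₃
    linarith
  have t₂ : (m + i + 1 + i).choose 2 + (m + i) * m =
      (m + i) + (m + i).choose 2 + (m + i) * (m + i) + (i + 1).choose 2 := by
    have h₁ := t (m + i + 1 + i)
    have h₂ := t (m + i)
    have h₃ := t (i + 1)
    zify
    push_cast at h₁ h₂ h₃
    linarith
  rw [e₀, hB, e₁, e₂]
  have u₁ : (X : ℤ⟦X⟧) ^ (m.choose 2) * X ^ ((m + i) * (m + 2 * i + 1)) =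
    X ^ ((m + i) + (m + i).choose 2 + (m + i) * (m + i)) * X ^ ((i + 1).choose 2) := by
    rw [← pow_add, ← pow_add, t₁]
  have u₂ : (X : ℤ⟦X⟧) ^ ((m + i + 1 + i).choose 2) * X ^ ((m + i) * m) =
    X ^ ((m + i) + (m + i).choose 2 + (m + i) * (m + i)) * X ^ ((i + 1).choose 2) := by
    rw [← pow_add, ← pow_add, t₂]
  have s' : (-1 : ℤ⟦X⟧) ^ (m + i + 1 + i) = -(-1) ^ m := by
    rw [show m + i + 1 + i = m + 1 + 2 * i by ring, pow_add, pow_mul]; simp [pow_succ]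
  have s'' : (-1 : ℤ⟦X⟧) ^ (m + i + 1) * (-1) ^ i = -(-1) ^ m := by
    rw [← s', pow_add _ _ i]
  rw [s']
  push_cast
  linear_combination (-(-1) ^ m * m * qBinom (2 * (m + i) + 1) (m + i + 1 + i)) * u₁ +
    ((-1) ^ m * (m + i + 1 + i) * qBinom (2 * (m + i) + 1) (m + i + 1 + i)) * u₂ +
    (X ^ ((m + i) + (m + i).choose 2 + (m + i) * (m + i)) * (2 * (i : ℤ⟦X⟧) + 1) *
      X ^ ((i + 1).choose 2) * qBinom (2 * (m + i) + 1) (m + i + 1 + i)) * s''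

/-! ### Passage to the limit: the coefficients of `E_1^3` -/

theorem X_pow_dvd_qPochhammer_sub {M m : ℕ} (hm : M ≤ m) (n : ℕ) :
    (X : ℤ⟦X⟧) ^ M ∣ qPochhammer (m + n) - qPochhammer m := by
  induction n with
  | zero => simp
  | succ n ih =>
    rw [← add_assoc, qPochhammer_succ]
    have : qPochhammer (m + n) * (1 - X ^ (m + n + 1)) - qPochhammer m =
        (qPochhammer (m + n) - qPochhammer m) - X ^ (m + n + 1) * qPochhammer (m + n) := by ring
    rw [this]
    exact dvd_sub ih (Dvd.dvd.mul_right (pow_dvd_pow _ (by omega)) _)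

theorem X_pow_dvd_eulerE_one_sub {M m : ℕ} (hm : M ≤ m) :
    (X : ℤ⟦X⟧) ^ M ∣ eulerE 1 - qPochhammer m := by
  rw [X_pow_dvd_iff]
  intro d hd
  have h := (multipliable_eulerE le_rfl).hasProd.tendsto_prod_nat
  have h' := ((WithPiTopology.continuous_coeff ℤ d).tendsto _).comp h
  have h'' : Filter.Tendsto (fun n => coeff d (qPochhammer n)) Filter.atTop
      (nhds (coeff d (eulerE 1))) := by
    simpa [Function.comp_def, eulerE, qPochhammer] using h'
  have hc : Filter.Tendsto (fun n => coeff d (qPochhammer n)) Filter.atTop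
      (nhds (coeff d (qPochhammer m))) := by
    refine tendsto_const_nhds.congr' (Filter.eventually_atTop.2 ⟨m, fun n hn => ?_⟩)
    obtain ⟨k, rfl⟩ := Nat.exists_eq_add_of_le hn
    have := X_pow_dvd_iff.1 (X_pow_dvd_qPochhammer_sub hm k) d hd
    rw [map_sub, sub_eq_zero] at this
    exact this.symm
  rw [map_sub, tendsto_nhds_unique h'' hc, sub_self]

theorem le_succ_choose_two (i : ℕ) : i ≤ (i + 1).choose 2 := by
  rw [Nat.choose_succ_succ' i 1, Nat.choose_one_right]
  exact Nat.le_add_right _ _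

/-- Modulo `q^M` every `(q; q)_m` with `m ≥ M` equals the unit `E_1`, so the binomials in the finite
identity become `1/E_1`, and `E_1^2` times that identity is Jacobi's. -/
theorem X_pow_dvd_eulerE_cube_sub (M : ℕ) :
    (X : ℤ⟦X⟧) ^ M ∣ eulerE 1 ^ 3 -
      ∑ i ∈ range (2 * M + 1), (-1) ^ i * (2 * (i : ℤ⟦X⟧) + 1) * X ^ ((i + 1).choose 2) := by
  rw [← Ideal.mem_span_singleton, ← Ideal.Quotient.eq]
  set π := Ideal.Quotient.mk (Ideal.span {(X : ℤ⟦X⟧) ^ M}) with hπ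
  have hP : ∀ m, M ≤ m → π (qPochhammer m) = π (eulerE 1) := fun m hm =>
    (Ideal.Quotient.eq.2 (Ideal.mem_span_singleton.2 (X_pow_dvd_eulerE_one_sub hm))).symm
  have hX : ∀ m, M ≤ m → π (X ^ m) = 0 := fun m hm =>
    Ideal.Quotient.eq_zero_iff_mem.2 (Ideal.mem_span_singleton.2 (pow_dvd_pow _ hm))
  have hu : IsUnit (π (eulerE 1)) := by
    refine IsUnit.map π (isUnit_iff_constantCoeff.2 ?_)
    rw [constantCoeff_eulerE le_rfl]
    exact isUnit_one
  -- Taking `n = 2M` ensures `2M - i ≥ M` whenever `i < M`; the terms with `i ≥ M` vanish because of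
  -- `q^(i(i+1)/2)`.
  have h := congrArg π (sum_qBinom_eq_qPochhammer_sq (2 * M))
  rw [map_pow, hP _ (by omega), map_sum] at h
  have key : ∀ i ∈ range (2 * M + 1),
      π ((-1) ^ i * (2 * (i : ℤ⟦X⟧) + 1) * X ^ ((i + 1).choose 2) *
        qBinom (2 * (2 * M) + 1) (2 * M + 1 + i)) * π (eulerE 1) ^ 2 =
      π ((-1) ^ i * (2 * (i : ℤ⟦X⟧) + 1) * X ^ ((i + 1).choose 2)) * π (eulerE 1) := by
    intro i hi
    rw [map_mul π _ (qBinom _ _), map_mul π _ (X ^ _)]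
    by_cases hM : M ≤ i
    · rw [hX _ (hM.trans (le_succ_choose_two i))]; ring
    · have := congrArg π (qBinom_add_mul_qPochhammer (2 * M - i) (2 * M + 1 + i))
      rw [show 2 * M - i + (2 * M + 1 + i) = 2 * (2 * M) + 1 by omega, map_mul, map_mul,
        hP _ (by omega), hP _ (by omega), hP _ (by omega)] at this
      linear_combination (π ((-1) ^ i * (2 * (i : ℤ⟦X⟧) + 1)) * π (X ^ (i + 1).choose 2)) * this
  have h' := congrArg (· * π (eulerE 1) ^ 2) h
  simp only [sum_mul] at h'
  rw [sum_congr rfl key, ← sum_mul, ← map_sum] at h'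
  rw [map_pow]
  refine hu.mul_right_cancel ?_
  rw [h']
  ring

theorem coeff_eulerE_cube (d N : ℕ) (hN : d < N) :
    coeff d (eulerE 1 ^ 3) =
      ∑ i ∈ range (2 * N + 1), if d = (i + 1).choose 2 then (-1) ^ i * (2 * (i : ℤ) + 1) else 0 := by
  have h := X_pow_dvd_iff.1 (X_pow_dvd_eulerE_cube_sub N) d hN
  rw [map_sub, sub_eq_zero, map_sum] at h
  rw [h]
  refine sum_congr rfl fun i _ => ?_
  have : ((-1) ^ i * (2 * (i : ℤ⟦X⟧) + 1)) = C ((-1) ^ i * (2 * (i : ℤ) + 1)) := by simp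
  rw [this, coeff_C_mul_X_pow]

theorem succ_choose_two_injective : Function.Injective fun i : ℕ => (i + 1).choose 2 := by
  refine (strictMono_nat_of_lt_succ fun i => ?_).injective
  have : (i + 1 + 1).choose 2 = i + 1 + (i + 1).choose 2 := by
    rw [Nat.choose_succ_succ' (i + 1) 1, Nat.choose_one_right]
  change (i + 1).choose 2 < (i + 1 + 1).choose 2
  omega

/-- Jacobi's identity `E_1^3 = ∑_i (-1)^i (2i+1) q^{i(i+1)/2}`: the coefficients at triangular
numbers. -/
theorem coeff_eulerE_cube_triangular (i : ℕ) :
    coeff ((i + 1).choose 2) (eulerE 1 ^ 3) = (-1) ^ i * (2 * (i : ℤ) + 1) := by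
  rw [coeff_eulerE_cube _ _ (Nat.lt_succ_self _), sum_eq_single i, if_pos rfl]
  · intro j _ hj
    rw [if_neg fun h => hj (succ_choose_two_injective h.symm)]
  · intro h
    have := le_succ_choose_two i
    rw [mem_range] at h
    omega

/-- Jacobi's identity `E_1^3 = ∑_i (-1)^i (2i+1) q^{i(i+1)/2}`: the vanishing coefficients. -/
theorem coeff_eulerE_cube_of_forall_ne {d : ℕ} (hd : ∀ i : ℕ, d ≠ (i + 1).choose 2) :
    coeff d (eulerE 1 ^ 3) = 0 := by
  rw [coeff_eulerE_cube _ _ (Nat.lt_succ_self _)]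
  exact sum_eq_zero fun i _ => if_neg (hd i)

/-! ### Dissection modulo 3, and the dissection of `E_1^3` -/

/-- The substitution `q ↦ q^3`. -/
noncomputable def expandThree (R : Type*) [CommRing R] : R⟦X⟧ →ₐ[R] R⟦X⟧ := expand 3 three_ne_zero

section
variable {R : Type*} [CommRing R]

theorem coeff_expandThree (f : R⟦X⟧) (n : ℕ) :
    coeff n (expandThree R f) = if 3 ∣ n then coeff (n / 3) f else 0 := by
  split_ifs with h
  · obtain ⟨m, rfl⟩ := h
    rw [expandThree, coeff_expand_mul, Nat.mul_div_cancel_left _ (by norm_num)]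
  · exact coeff_expand_of_not_dvd _ _ _ h

theorem expandThree_X : expandThree R X = X ^ 3 := expand_X _ _

theorem expandThree_injective : Function.Injective (expandThree R) := by
  intro f g h
  ext n
  have := congrArg (coeff (3 * n)) h
  simpa [coeff_expandThree] using this

theorem continuous_expandThree [TopologicalSpace R] : Continuous (expandThree R) := by
  rw [continuous_iff_continuousAt]
  intro f
  refine (WithPiTopology.tendsto_iff_coeff_tendsto R _ _ _).2 fun d => ?_
  simp only [coeff_expandThree]
  split_ifs
  · exact (WithPiTopology.continuous_coeff R _).tendsto _
  · exact tendsto_const_nhds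

theorem coeff_dissection_zero (a b c : R⟦X⟧) (n : ℕ) :
    coeff (3 * n) (expandThree R a + X * expandThree R b + X ^ 2 * expandThree R c) = coeff n a := by
  rw [← pow_one X, map_add, map_add, coeff_X_pow_mul', ← pow_mul, coeff_X_pow_mul']
  simp only [coeff_expandThree]
  rw [if_pos ⟨n, rfl⟩, Nat.mul_div_cancel_left _ (by norm_num)]
  split_ifs <;> first | omega | simp

theorem coeff_dissection_one (a b c : R⟦X⟧) (n : ℕ) :
    coeff (3 * n + 1) (expandThree R a + X * expandThree R b + X ^ 2 * expandThree R c) =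
      coeff n b := by
  rw [← pow_one X, map_add, map_add, coeff_X_pow_mul', ← pow_mul, coeff_X_pow_mul']
  simp only [coeff_expandThree]
  rw [Nat.add_sub_cancel, Nat.mul_div_cancel_left _ (by norm_num)]
  split_ifs <;> first | omega | simp

theorem coeff_dissection_two (a b c : R⟦X⟧) (n : ℕ) :
    coeff (3 * n + 2) (expandThree R a + X * expandThree R b + X ^ 2 * expandThree R c) =
      coeff n c := by
  rw [← pow_one X, map_add, map_add, coeff_X_pow_mul', ← pow_mul, coeff_X_pow_mul']
  simp only [coeff_expandThree]
  rw [show 3 * n + 2 - 1 * 2 = 3 * n by omega, Nat.mul_div_cancel_left _ (by norm_num)]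
  split_ifs <;> first | omega | simp

end

theorem expandThree_eulerE {k : ℕ} (hk : 1 ≤ k) : expandThree ℤ (eulerE k) = eulerE (3 * k) := by
  rw [eulerE, (multipliable_eulerE hk).map_tprod _ continuous_expandThree, eulerE]
  refine tprod_congr fun n => ?_
  rw [map_sub, map_one, map_pow, expandThree_X, ← pow_mul, mul_assoc]

theorem succ_choose_two_three_mul_add_one (i : ℕ) :
    (3 * i + 1 + 1).choose 2 = 9 * (i + 1).choose 2 + 1 := by
  have h₁ := two_mul_succ_choose_two (3 * i + 1)
  have h₂ := two_mul_succ_choose_two i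
  linarith

theorem three_dvd_succ_choose_two {i : ℕ} (hi : i % 3 ≠ 1) : 3 ∣ (i + 1).choose 2 := by
  have h : 3 ∣ 2 * (i + 1).choose 2 := by
    rw [two_mul_succ_choose_two]
    rcases (show i % 3 = 0 ∨ i % 3 = 2 by omega) with h | h
    · exact Dvd.dvd.mul_left (by omega) _
    · exact Dvd.dvd.mul_right (by omega) _
  exact Nat.Coprime.dvd_of_dvd_mul_left (by norm_num) h

theorem coeff_eulerE_cube_three_mul_add_two (n : ℕ) : coeff (3 * n + 2) (eulerE 1 ^ 3) = 0 := by
  refine coeff_eulerE_cube_of_forall_ne fun i hi => ?_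
  by_cases h : i % 3 = 1
  · obtain ⟨k, rfl⟩ : ∃ k, i = 3 * k + 1 := ⟨i / 3, by omega⟩
    rw [succ_choose_two_three_mul_add_one] at hi
    omega
  · have := three_dvd_succ_choose_two h
    omega

/-- Triangular numbers congruent to 1 modulo 3 come exactly from indices `3k + 1`, at exponent `9
k(k+1)/2 + 1`, with weight `(-1)^(3k+1) (6k + 3) = -3 (-1)^k (2k + 1)`. -/
theorem coeff_eulerE_cube_three_mul_add_one (n : ℕ) :
    coeff (3 * n + 1) (eulerE 1 ^ 3) = -3 * coeff n (eulerE 3 ^ 3) := by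
  rw [show eulerE 3 ^ 3 = expandThree ℤ (eulerE 1 ^ 3) by
    rw [map_pow, expandThree_eulerE le_rfl], coeff_expandThree]
  by_cases h : ∃ i, n = 3 * (i + 1).choose 2
  · obtain ⟨i, rfl⟩ := h
    rw [if_pos ⟨_, rfl⟩, Nat.mul_div_cancel_left _ (by norm_num), coeff_eulerE_cube_triangular,
      show 3 * (3 * (i + 1).choose 2) + 1 = (3 * i + 1 + 1).choose 2 by
        rw [succ_choose_two_three_mul_add_one]; ring, coeff_eulerE_cube_triangular, pow_succ,
      pow_mul]
    push_cast
    norm_num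
    ring
  · push Not at h
    rw [coeff_eulerE_cube_of_forall_ne]
    · split_ifs with h3
      · rw [coeff_eulerE_cube_of_forall_ne, mul_zero]
        intro i hi
        exact h i (by omega)
      · simp
    · intro i hi
      by_cases h3 : i % 3 = 1
      · obtain ⟨k, rfl⟩ : ∃ k, i = 3 * k + 1 := ⟨i / 3, by omega⟩
        rw [succ_choose_two_three_mul_add_one] at hi
        exact h k (by omega)
      · have := three_dvd_succ_choose_two h3
        omega

/-- The series `P` with `E_1^3 = P(q^3) - 3 q E_9^3`. -/
noncomputable def eulerCubePart : ℤ⟦X⟧ := mk fun n => coeff (3 * n) (eulerE 1 ^ 3)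

theorem eulerE_one_cube_dissection :
    eulerE 1 ^ 3 = expandThree ℤ eulerCubePart - 3 * X * expandThree ℤ (eulerE 3 ^ 3) := by
  have h : expandThree ℤ eulerCubePart - 3 * X * expandThree ℤ (eulerE 3 ^ 3) =
      expandThree ℤ eulerCubePart + X * expandThree ℤ (C (-3) * eulerE 3 ^ 3) +
        X ^ 2 * expandThree ℤ 0 := by
    rw [map_mul, show (C (-3 : ℤ) : ℤ⟦X⟧) = -3 by simp, map_zero, map_neg, map_ofNat]
    ring
  rw [h]
  ext d
  obtain ⟨n, hn⟩ : ∃ n, d = 3 * n ∨ d = 3 * n + 1 ∨ d = 3 * n + 2 := ⟨d / 3, by omega⟩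
  rcases hn with rfl | rfl | rfl
  · rw [coeff_dissection_zero, eulerCubePart, coeff_mk]
  · rw [coeff_dissection_one, coeff_eulerE_cube_three_mul_add_one, coeff_C_mul]
  · rw [coeff_dissection_two, coeff_eulerE_cube_three_mul_add_two, map_zero]

/-! ### Cube roots of unity and the cubic relation for `P` -/

/-- The ring homomorphism `f(q) ↦ f(ζ q)` from integer to complex power series. -/
noncomputable def twist (ζ : ℂ) : ℤ⟦X⟧ →+* ℂ⟦X⟧ := (rescale ζ).comp (map (Int.castRingHom ℂ))

theorem coeff_twist (ζ : ℂ) (f : ℤ⟦X⟧) (n : ℕ) : coeff n (twist ζ f) = ζ ^ n * ((coeff n f : ℤ) : ℂ) := by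
  simp [twist]

theorem twist_X (ζ : ℂ) : twist ζ X = C ζ * X := by
  simp [twist, rescale_X]

theorem twist_one_injective : Function.Injective (twist 1) := by
  intro f g h
  ext n
  have := congrArg (coeff n) h
  simpa [coeff_twist] using this

theorem continuous_twist (ζ : ℂ) : Continuous (twist ζ) := by
  rw [continuous_iff_continuousAt]
  intro f
  refine (WithPiTopology.tendsto_iff_coeff_tendsto ℂ _ _ _).2 fun d => ?_
  simp only [coeff_twist]
  exact ((continuous_of_discreteTopology (f := fun a : ℤ => ζ ^ d * (a : ℂ))).comp
    (WithPiTopology.continuous_coeff ℤ d)).tendsto f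

theorem twist_expandThree {ζ : ℂ} (hζ : ζ ^ 3 = 1) (f : ℤ⟦X⟧) :
    twist ζ (expandThree ℤ f) = twist 1 (expandThree ℤ f) := by
  ext n
  rw [coeff_twist, coeff_twist, coeff_expandThree]
  split_ifs with h
  · obtain ⟨m, rfl⟩ := h
    simp [pow_mul, hζ]
  · simp

theorem sub_mul_sub_mul_sub_eq_cube_sub_cube {ω : ℂ} (hω : IsPrimitiveRoot ω 3) (a b : ℂ⟦X⟧) :
    (a - b) * (a - C ω * b) * (a - C (ω ^ 2) * b) = a ^ 3 - b ^ 3 := by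
  have h : 1 + ω + ω ^ 2 = 0 := by
    have := hω.geom_sum_eq_zero (by norm_num)
    simpa [sum_range_succ] using this
  have h' : 1 + C ω + C ω ^ 2 = (0 : ℂ⟦X⟧) := by
    rw [← map_pow, ← map_one C, ← map_add, ← map_add, h, map_zero]
  rw [map_pow]
  linear_combination (-a ^ 2 * b + C ω * a * b ^ 2 - (C ω - 1) * b ^ 3) * h'

theorem prod_twist_one_sub_X_pow {ω : ℂ} (hω : IsPrimitiveRoot ω 3) {n : ℕ} (hn : ¬ 3 ∣ n) :
    twist 1 (1 - X ^ n) * twist ω (1 - X ^ n) * twist (ω ^ 2) (1 - X ^ n) =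
      twist 1 (1 - X ^ (3 * n)) := by
  have h := sub_mul_sub_mul_sub_eq_cube_sub_cube (hω.pow_of_coprime n
    ((Nat.Prime.coprime_iff_not_dvd Nat.prime_three).2 hn).symm) 1 (X ^ n)
  simp only [map_sub, map_one, map_pow, twist_X, mul_pow, one_mul, one_pow] at h ⊢
  rw [pow_mul', ← h]
  ring

/-- Exponents `n` prime to 3 contribute `1 - q^(3n)`, while `n = 3m` contributes `(1 - q^(3m))^3`.
The last factor on the left compensates for the factors `1 - q^(9m)` included in the first product
on the right. -/
theorem prod_twist_qPochhammer {ω : ℂ} (hω : IsPrimitiveRoot ω 3) (N : ℕ) :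
    twist 1 (qPochhammer (3 * N)) * twist ω (qPochhammer (3 * N)) *
        twist (ω ^ 2) (qPochhammer (3 * N)) *
        twist 1 (expandThree ℤ (expandThree ℤ (qPochhammer N))) =
      twist 1 (expandThree ℤ (qPochhammer (3 * N))) *
        twist 1 (expandThree ℤ (qPochhammer N)) ^ 3 := by
  induction N with
  | zero => simp [qPochhammer]
  | succ N ih =>
    have h₁ := prod_twist_one_sub_X_pow hω (n := 3 * N + 1) (by omega)
    have h₂ := prod_twist_one_sub_X_pow hω (n := 3 * N + 1 + 1) (by omega)
    have h₃ : ∀ n, expandThree ℤ (1 - X ^ n) = 1 - X ^ (3 * n) := fun n => by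
      rw [map_sub, map_one, map_pow, expandThree_X, pow_mul]
    have hω3 : (ω ^ 2) ^ 3 = 1 := by rw [← pow_mul, mul_comm, pow_mul, hω.pow_eq_one, one_pow]
    have h₄ := twist_expandThree hω.pow_eq_one (1 - X ^ (N + 1))
    have h₅ := twist_expandThree hω3 (1 - X ^ (N + 1))
    rw [h₃] at h₄ h₅
    rw [show 3 * (N + 1) = 3 * N + 1 + 1 + 1 by ring]
    simp only [qPochhammer_succ, map_mul (twist _), map_mul (expandThree ℤ), h₃]
    rw [show 3 * N + 1 + 1 + 1 = 3 * (N + 1) by ring, h₄, h₅, ← h₁, ← h₂]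
    linear_combination
      (twist 1 (1 - X ^ (3 * N + 1)) * twist ω (1 - X ^ (3 * N + 1)) *
        twist (ω ^ 2) (1 - X ^ (3 * N + 1))) *
      (twist 1 (1 - X ^ (3 * N + 1 + 1)) * twist ω (1 - X ^ (3 * N + 1 + 1)) *
        twist (ω ^ 2) (1 - X ^ (3 * N + 1 + 1))) *
      twist 1 (1 - X ^ (3 * (N + 1))) ^ 3 * twist 1 (1 - X ^ (3 * (3 * (N + 1)))) * ih

theorem tendsto_qPochhammer :
    Filter.Tendsto qPochhammer Filter.atTop (nhds (eulerE 1)) := by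
  have h := (multipliable_eulerE le_rfl).hasProd.tendsto_prod_nat
  simp only [one_mul] at h
  simp only [eulerE, one_mul]
  exact h

theorem prod_twist_eulerE {ω : ℂ} (hω : IsPrimitiveRoot ω 3) :
    twist 1 (eulerE 1) * twist ω (eulerE 1) * twist (ω ^ 2) (eulerE 1) * twist 1 (eulerE 9) =
      twist 1 (eulerE 3) * twist 1 (eulerE 3) ^ 3 := by
  have h₃ : Filter.Tendsto (fun N => qPochhammer (3 * N)) Filter.atTop (nhds (eulerE 1)) :=
    tendsto_qPochhammer.comp (Filter.tendsto_atTop_mono (fun n => Nat.le_mul_of_pos_left n three_pos) Filter.tendsto_id)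
  have ht : ∀ ζ, Filter.Tendsto (twist ζ) (nhds (eulerE 1)) (nhds (twist ζ (eulerE 1))) :=
    fun ζ => (continuous_twist ζ).tendsto _
  have he : Filter.Tendsto (fun f => twist 1 (expandThree ℤ f)) (nhds (eulerE 1))
      (nhds (twist 1 (expandThree ℤ (eulerE 1)))) :=
    ((continuous_twist 1).comp continuous_expandThree).tendsto _
  have hee : Filter.Tendsto (fun f => twist 1 (expandThree ℤ (expandThree ℤ f))) (nhds (eulerE 1))
      (nhds (twist 1 (expandThree ℤ (expandThree ℤ (eulerE 1))))) :=
    ((continuous_twist 1).comp (continuous_expandThree.comp continuous_expandThree)).tendsto _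
  have hl := ((((ht 1).comp h₃).mul ((ht ω).comp h₃)).mul ((ht (ω ^ 2)).comp h₃)).mul
    (hee.comp tendsto_qPochhammer)
  have hr := (he.comp h₃).mul ((he.comp tendsto_qPochhammer).pow 3)
  rw [expandThree_eulerE le_rfl] at hl hr
  rw [expandThree_eulerE (by norm_num)] at hl
  refine tendsto_nhds_unique hl (hr.congr fun N => ?_)
  exact (prod_twist_qPochhammer hω N).symm

/-- The twists of `E_1^3` are `A - ζ t`, with product `A^3 - t^3`; by the Euler product this is also
`(E_3^4 / E_9)^3`. The identity is the result of undoing `q ↦ q^3`. -/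
theorem eulerCubePart_cube :
    (eulerCubePart ^ 3 - 27 * X * eulerE 3 ^ 9) * eulerE 3 ^ 3 = eulerE 1 ^ 12 := by
  have hω := Complex.isPrimitiveRoot_exp 3 (by norm_num)
  set ω := Complex.exp (2 * Real.pi * Complex.I / (3 : ℕ)) with hω_def
  have hω3 : (ω ^ 2) ^ 3 = 1 := by rw [← pow_mul, mul_comm, pow_mul, hω.pow_eq_one, one_pow]
  have htw : ∀ ζ : ℂ, ζ ^ 3 = 1 → twist ζ (eulerE 1) ^ 3 = twist 1 (expandThree ℤ eulerCubePart) -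
      C ζ * (3 * X * twist 1 (expandThree ℤ (eulerE 3 ^ 3))) := by
    intro ζ hζ
    rw [← map_pow, eulerE_one_cube_dissection, map_sub, map_mul, map_mul, map_ofNat, twist_X,
      twist_expandThree hζ, twist_expandThree hζ]
    ring
  have h₁ := sub_mul_sub_mul_sub_eq_cube_sub_cube hω (twist 1 (expandThree ℤ eulerCubePart))
    (3 * X * twist 1 (expandThree ℤ (eulerE 3 ^ 3)))
  rw [← htw ω hω.pow_eq_one, ← htw _ hω3] at h₁
  have h₂ := htw 1 (one_pow 3)
  rw [map_one, one_mul] at h₂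
  rw [← h₂] at h₁
  have h₃ := prod_twist_eulerE hω
  apply expandThree_injective
  apply twist_one_injective
  have e₁ : expandThree ℤ (eulerE 1) = eulerE 3 := expandThree_eulerE le_rfl
  have e₃ : expandThree ℤ (eulerE 3) = eulerE 9 := expandThree_eulerE (by norm_num)
  simp only [map_mul, map_sub, map_pow, map_ofNat, expandThree_X, e₁, e₃, twist_X, map_one,
    one_mul] at h₁ ⊢
  have h₄ := congrArg (· ^ 3) h₃
  simp only [mul_pow] at h₄
  rw [h₁] at h₄
  linear_combination h₄

/-! ### Powers of `A^2 + A t + t^2`, sorted by the exponent of `t` modulo 3 -/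

section
variable {S : Type*} [CommRing S] {A t Z Z' w : S}

theorem trinomial_pow_four (hA : A ^ 3 = Z * (1 + w)) (ht : t ^ 3 = Z * w) (hZ : Z * Z' = 1) :
    (A ^ 2 + A * t + t ^ 2) ^ 4 * Z' ^ 2 =
      t ^ 2 * (10 * (1 + w) ^ 2 + 16 * (1 + w) * w + w ^ 2) +
      A * t * (4 * (1 + w) ^ 2 + 19 * (1 + w) * w + 4 * w ^ 2) +
      A ^ 2 * ((1 + w) ^ 2 + 16 * (1 + w) * w + 10 * w ^ 2) := by
  have h : (A ^ 2 + A * t + t ^ 2) ^ 4 =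
      t ^ 2 * (10 * (A ^ 3) ^ 2 + 16 * A ^ 3 * t ^ 3 + (t ^ 3) ^ 2) +
      A * t * (4 * (A ^ 3) ^ 2 + 19 * A ^ 3 * t ^ 3 + 4 * (t ^ 3) ^ 2) +
      A ^ 2 * ((A ^ 3) ^ 2 + 16 * A ^ 3 * t ^ 3 + 10 * (t ^ 3) ^ 2) := by ring
  have hZ₂ : Z ^ 2 * Z' ^ 2 = 1 := by rw [← mul_pow, hZ, one_pow]
  rw [h, hA, ht]
  linear_combination (t ^ 2 * (10 * (1 + w) ^ 2 + 16 * (1 + w) * w + w ^ 2) +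
      A * t * (4 * (1 + w) ^ 2 + 19 * (1 + w) * w + 4 * w ^ 2) +
      A ^ 2 * ((1 + w) ^ 2 + 16 * (1 + w) * w + 10 * w ^ 2)) * hZ₂

theorem mul_trinomial_pow_four (hA : A ^ 3 = Z * (1 + w)) (ht : t ^ 3 = Z * w) (hZ : Z * Z' = 1) :
    t * (A ^ 2 + A * t + t ^ 2) ^ 4 * Z' ^ 3 =
      w * (10 * (1 + w) ^ 2 + 16 * (1 + w) * w + w ^ 2) +
      Z' * A ^ 2 * t * ((1 + w) ^ 2 + 16 * (1 + w) * w + 10 * w ^ 2) +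
      Z' * A * t ^ 2 * (4 * (1 + w) ^ 2 + 19 * (1 + w) * w + 4 * w ^ 2) := by
  linear_combination t * Z' * trinomial_pow_four hA ht hZ +
    Z' * (10 * (1 + w) ^ 2 + 16 * (1 + w) * w + w ^ 2) * ht +
    w * (10 * (1 + w) ^ 2 + 16 * (1 + w) * w + w ^ 2) * hZ

/-- The factors 3 are the point: modulo 3 the trinomial is `(A - t)^2`, so its sixth power is `(A^3
- t^3)^4`, in which only exponents of `t` divisible by 3 occur. -/
theorem trinomial_pow_six (hA : A ^ 3 = Z * (1 + w)) (ht : t ^ 3 = Z * w) (hZ : Z * Z' = 1) :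
    (A ^ 2 + A * t + t ^ 2) ^ 6 * Z' ^ 4 =
      ((1 + w) ^ 4 + 50 * (1 + w) ^ 3 * w + 141 * (1 + w) ^ 2 * w ^ 2 + 50 * (1 + w) * w ^ 3 +
        w ^ 4) +
      Z' * A ^ 2 * t * (3 * (2 * (1 + w) ^ 3 + 30 * (1 + w) ^ 2 * w + 42 * (1 + w) * w ^ 2 +
        7 * w ^ 3)) +
      Z' * A * t ^ 2 * (3 * (7 * (1 + w) ^ 3 + 42 * (1 + w) ^ 2 * w + 30 * (1 + w) * w ^ 2 +
        2 * w ^ 3)) := by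
  have h : (A ^ 2 + A * t + t ^ 2) ^ 6 =
      ((A ^ 3) ^ 4 + 50 * (A ^ 3) ^ 3 * t ^ 3 + 141 * (A ^ 3) ^ 2 * (t ^ 3) ^ 2 +
        50 * A ^ 3 * (t ^ 3) ^ 3 + (t ^ 3) ^ 4) +
      A ^ 2 * t * (3 * (2 * (A ^ 3) ^ 3 + 30 * (A ^ 3) ^ 2 * t ^ 3 + 42 * A ^ 3 * (t ^ 3) ^ 2 +
        7 * (t ^ 3) ^ 3)) +
      A * t ^ 2 * (3 * (7 * (A ^ 3) ^ 3 + 42 * (A ^ 3) ^ 2 * t ^ 3 + 30 * A ^ 3 * (t ^ 3) ^ 2 +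
        2 * (t ^ 3) ^ 3)) := by ring
  have hZ₃ : Z ^ 3 * Z' ^ 3 = 1 := by rw [← mul_pow, hZ, one_pow]
  have hZ₄ : Z ^ 4 * Z' ^ 4 = 1 := by rw [← mul_pow, hZ, one_pow]
  rw [h, hA, ht]
  linear_combination ((1 + w) ^ 4 + 50 * (1 + w) ^ 3 * w + 141 * (1 + w) ^ 2 * w ^ 2 +
      50 * (1 + w) * w ^ 3 + w ^ 4) * hZ₄ +
    (Z' * A ^ 2 * t * (3 * (2 * (1 + w) ^ 3 + 30 * (1 + w) ^ 2 * w + 42 * (1 + w) * w ^ 2 +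
        7 * w ^ 3)) +
      Z' * A * t ^ 2 * (3 * (7 * (1 + w) ^ 3 + 42 * (1 + w) ^ 2 * w + 30 * (1 + w) * w ^ 2 +
        2 * w ^ 3))) * hZ₃

end

/-! ### The series `W` and the dissection of `1/E_1^3` -/

/-- The inverse series `1 / E_k`. -/
noncomputable def eulerInv (k : ℕ) : ℤ⟦X⟧ := invOfUnit (eulerE k) 1

theorem eulerE_mul_eulerInv {k : ℕ} (hk : 1 ≤ k) : eulerE k * eulerInv k = 1 :=
  mul_invOfUnit _ _ (constantCoeff_eulerE hk)

theorem expandThree_eulerInv {k : ℕ} (hk : 1 ≤ k) :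
    expandThree ℤ (eulerInv k) = eulerInv (3 * k) := by
  have h₁ := congrArg (expandThree ℤ) (eulerE_mul_eulerInv hk)
  have h₂ := eulerE_mul_eulerInv (k := 3 * k) (by omega)
  rw [map_mul, map_one, expandThree_eulerE hk] at h₁
  rw [mul_comm] at h₁
  exact left_inv_eq_right_inv h₁ h₂

/-- The series `W = 27 q E_3^12 / E_1^12`. -/
noncomputable def eulerQuot : ℤ⟦X⟧ := 27 * X * eulerE 3 ^ 12 * eulerInv 1 ^ 12

/-- The series `P(q^3)` in `E_1^3 = P(q^3) - 3 q E_9^3`. -/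
noncomputable def cubeMain : ℤ⟦X⟧ := expandThree ℤ eulerCubePart

/-- The series `3 q E_9^3` in `E_1^3 = P(q^3) - 3 q E_9^3`. -/
noncomputable def cubeTail : ℤ⟦X⟧ := 3 * X * expandThree ℤ (eulerE 3 ^ 3)

/-- The series `E_3 ^ 3 / E_1 ^ 12`. -/
noncomputable def normInv : ℤ⟦X⟧ := eulerE 3 ^ 3 * eulerInv 1 ^ 12

theorem norm_mul_normInv : eulerE 1 ^ 12 * eulerInv 3 ^ 3 * normInv = 1 := by
  have h₁ : eulerE 1 ^ 12 * eulerInv 1 ^ 12 = 1 := by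
    rw [← mul_pow, eulerE_mul_eulerInv le_rfl, one_pow]
  have h₃ : eulerE 3 ^ 3 * eulerInv 3 ^ 3 = 1 := by
    rw [← mul_pow, eulerE_mul_eulerInv (by norm_num), one_pow]
  rw [normInv]
  linear_combination eulerE 3 ^ 3 * eulerInv 3 ^ 3 * h₁ + h₃

theorem expandThree_norm_mul :
    expandThree ℤ (eulerE 1 ^ 12 * eulerInv 3 ^ 3) * expandThree ℤ normInv = 1 := by
  rw [← map_mul, norm_mul_normInv, map_one]

theorem norm_mul_eulerQuot :
    eulerE 1 ^ 12 * eulerInv 3 ^ 3 * eulerQuot = 27 * X * eulerE 3 ^ 9 := by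
  have h₁ : eulerE 1 ^ 12 * eulerInv 1 ^ 12 = 1 := by
    rw [← mul_pow, eulerE_mul_eulerInv le_rfl, one_pow]
  have h₃ : eulerE 3 ^ 3 * eulerInv 3 ^ 3 = 1 := by
    rw [← mul_pow, eulerE_mul_eulerInv (by norm_num), one_pow]
  rw [eulerQuot]
  linear_combination 27 * X * eulerE 3 ^ 12 * eulerInv 3 ^ 3 * h₁ + 27 * X * eulerE 3 ^ 9 * h₃

theorem cubeTail_cube : cubeTail ^ 3 =
    expandThree ℤ (eulerE 1 ^ 12 * eulerInv 3 ^ 3) * expandThree ℤ eulerQuot := by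
  rw [← map_mul, norm_mul_eulerQuot, cubeTail]
  simp only [map_mul, map_pow, map_ofNat, expandThree_X]
  ring

theorem cubeMain_cube : cubeMain ^ 3 =
    expandThree ℤ (eulerE 1 ^ 12 * eulerInv 3 ^ 3) * (1 + expandThree ℤ eulerQuot) := by
  have h₃ : eulerE 3 ^ 3 * eulerInv 3 ^ 3 = 1 := by
    rw [← mul_pow, eulerE_mul_eulerInv (by norm_num), one_pow]
  rw [cubeMain, ← map_pow, ← map_one (expandThree ℤ), ← map_add, ← map_mul]
  congr 1
  linear_combination eulerInv 3 ^ 3 * eulerCubePart_cube - norm_mul_eulerQuot -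
    (eulerCubePart ^ 3 - 27 * X * eulerE 3 ^ 9) * h₃

/-- Rationalise `1/(A - t)` by the difference of cubes; `A^3 - t^3` is inverted by `normInv` at
`q^3`. -/
theorem eulerInv_one_cube : eulerInv 1 ^ 3 =
    (cubeMain ^ 2 + cubeMain * cubeTail + cubeTail ^ 2) * expandThree ℤ normInv := by
  have h₁ : eulerE 1 ^ 3 * eulerInv 1 ^ 3 = 1 := by
    rw [← mul_pow, eulerE_mul_eulerInv le_rfl, one_pow]
  have h₂ : eulerE 1 ^ 3 = cubeMain - cubeTail := eulerE_one_cube_dissection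
  have h₃ := cubeMain_cube
  have h₄ := cubeTail_cube
  have h₅ := expandThree_norm_mul
  have key : eulerE 1 ^ 3 * ((cubeMain ^ 2 + cubeMain * cubeTail + cubeTail ^ 2) *
      expandThree ℤ normInv) = 1 := by
    rw [h₂]
    linear_combination expandThree ℤ normInv * (h₃ - h₄) + h₅
  rw [mul_comm] at h₁
  exact left_inv_eq_right_inv h₁ key

theorem expandThree_normInv_mul : expandThree ℤ normInv * eulerE 3 ^ 12 =
    expandThree ℤ (eulerE 3 ^ 3) := by
  have h₁ : eulerE 3 ^ 12 * eulerInv 3 ^ 12 = 1 := by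
    rw [← mul_pow, eulerE_mul_eulerInv (by norm_num), one_pow]
  rw [normInv, map_mul, map_pow _ (eulerInv 1), expandThree_eulerInv le_rfl]
  linear_combination expandThree ℤ (eulerE 3 ^ 3) * h₁

/-- `W / 9`, expressed through the dissection of `E_1^3`. -/
theorem eulerQuot_eq : eulerQuot = 9 * (cubeTail *
    (cubeMain ^ 2 + cubeMain * cubeTail + cubeTail ^ 2) ^ 4 * expandThree ℤ normInv ^ 3) := by
  rw [eulerQuot, show eulerInv 1 ^ 12 = (eulerInv 1 ^ 3) ^ 4 by ring, eulerInv_one_cube]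
  have h := expandThree_normInv_mul
  have hT : cubeTail = 3 * X * expandThree ℤ (eulerE 3 ^ 3) := rfl
  generalize cubeMain ^ 2 + cubeMain * cubeTail + cubeTail ^ 2 = Q
  rw [hT]
  linear_combination 27 * X * Q ^ 4 * expandThree ℤ normInv ^ 3 * h

/-! ### Dissecting elements of `ℤ[W]` -/

/-- The ring `ℤ[W]`. -/
noncomputable def quotRing : Subring ℤ⟦X⟧ := Subring.closure {eulerQuot}

theorem eulerQuot_mem : eulerQuot ∈ quotRing := Subring.subset_closure rfl

/-- The elements `G₀(q^3) + α G₁(q^3) + β G₂(q^3)` with `Gᵢ ∈ ℤ[W]`, where `α = A² t / z` and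
`β = A t² / z` for `A = P(q^3)`, `t = 3 q E_9^3` and `z = A³ - t³`. -/
def IsDissected (f : ℤ⟦X⟧) : Prop :=
  ∃ G₀ ∈ quotRing, ∃ G₁ ∈ quotRing, ∃ G₂ ∈ quotRing,
    f = expandThree ℤ G₀ + expandThree ℤ normInv * cubeMain ^ 2 * cubeTail * expandThree ℤ G₁ +
      expandThree ℤ normInv * cubeMain * cubeTail ^ 2 * expandThree ℤ G₂

theorem IsDissected.intCast (c : ℤ) : IsDissected c :=
  ⟨c, intCast_mem _ c, 0, zero_mem _, 0, zero_mem _, by simp⟩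

theorem IsDissected.add {f g : ℤ⟦X⟧} (hf : IsDissected f) (hg : IsDissected g) :
    IsDissected (f + g) := by
  obtain ⟨F₀, hF₀, F₁, hF₁, F₂, hF₂, rfl⟩ := hf
  obtain ⟨G₀, hG₀, G₁, hG₁, G₂, hG₂, rfl⟩ := hg
  refine ⟨F₀ + G₀, add_mem hF₀ hG₀, F₁ + G₁, add_mem hF₁ hG₁, F₂ + G₂, add_mem hF₂ hG₂, ?_⟩
  simp only [map_add]
  ring

/-- Closure rests on `αβ = w(1 + w)`, `α^2 = (1 + w) β` and `β^2 = w α`, where `w = W(q^3)`. -/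
theorem IsDissected.mul {f g : ℤ⟦X⟧} (hf : IsDissected f) (hg : IsDissected g) :
    IsDissected (f * g) := by
  obtain ⟨F₀, hF₀, F₁, hF₁, F₂, hF₂, rfl⟩ := hf
  obtain ⟨G₀, hG₀, G₁, hG₁, G₂, hG₂, rfl⟩ := hg
  have hW := eulerQuot_mem
  have hW' := add_mem (one_mem quotRing) hW
  refine ⟨F₀ * G₀ + eulerQuot * (1 + eulerQuot) * (F₁ * G₂ + F₂ * G₁),
    add_mem (mul_mem hF₀ hG₀) (mul_mem (mul_mem hW hW') (add_mem (mul_mem hF₁ hG₂) (mul_mem hF₂ hG₁))),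
    F₀ * G₁ + F₁ * G₀ + eulerQuot * (F₂ * G₂),
    add_mem (add_mem (mul_mem hF₀ hG₁) (mul_mem hF₁ hG₀)) (mul_mem hW (mul_mem hF₂ hG₂)),
    F₀ * G₂ + F₂ * G₀ + (1 + eulerQuot) * (F₁ * G₁),
    add_mem (add_mem (mul_mem hF₀ hG₂) (mul_mem hF₂ hG₀)) (mul_mem hW' (mul_mem hF₁ hG₁)), ?_⟩
  simp only [map_add, map_mul, map_one]
  have hA := cubeMain_cube
  have ht := cubeTail_cube
  have hZ := expandThree_norm_mul
  generalize expandThree ℤ (eulerE 1 ^ 12 * eulerInv 3 ^ 3) = Z at hA ht hZ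
  generalize expandThree ℤ normInv = Z' at hZ ⊢
  generalize expandThree ℤ eulerQuot = w at hA ht ⊢
  generalize cubeMain = A at hA ⊢
  generalize cubeTail = t at ht ⊢
  generalize expandThree ℤ F₀ = f₀
  generalize expandThree ℤ F₁ = f₁
  generalize expandThree ℤ F₂ = f₂
  generalize expandThree ℤ G₀ = g₀
  generalize expandThree ℤ G₁ = g₁
  generalize expandThree ℤ G₂ = g₂
  have hA' : Z' * A ^ 3 = 1 + w := by linear_combination Z' * hA + (1 + w) * hZ
  have ht' : Z' * t ^ 3 = w := by linear_combination Z' * ht + w * hZ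
  linear_combination ((f₁ * g₂ + f₂ * g₁) * Z' * t ^ 3 + f₁ * g₁ * Z' * A * t ^ 2) * hA' +
    ((f₁ * g₂ + f₂ * g₁) * (1 + w) + f₂ * g₂ * Z' * A ^ 2 * t) * ht'

/-- The integers plus 9 times the dissected series form a ring, and it contains `W` because `W/9 = t
(A^2 + A t + t^2)^4 / z^3` is dissected. The factor 9 preserves the extra 3 in
`dissection_evenLevel`. -/
theorem exists_eq_intCast_add_nine_mul {F : ℤ⟦X⟧} (hF : F ∈ quotRing) :
    ∃ (c : ℤ) (f : ℤ⟦X⟧), IsDissected f ∧ F = c + 9 * f := by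
  have hneg : ∀ f, IsDissected f → IsDissected (-f) := fun f hf => by
    have := (IsDissected.intCast (-1)).mul hf
    rwa [Int.cast_neg, Int.cast_one, neg_one_mul] at this
  induction hF using Subring.closure_induction with
  | mem x hx =>
    rw [Set.mem_singleton_iff] at hx
    refine ⟨0, _, ?_, by rw [hx, Int.cast_zero, zero_add]; exact eulerQuot_eq⟩
    have hW := eulerQuot_mem
    have hW' := add_mem (one_mem quotRing) hW
    have hn : ∀ n : ℕ, (n : ℤ⟦X⟧) ∈ quotRing := natCast_mem _
    have h := mul_trinomial_pow_four cubeMain_cube cubeTail_cube expandThree_norm_mul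
    refine ⟨eulerQuot * (((10 : ℕ) : ℤ⟦X⟧) * (1 + eulerQuot) ^ 2 +
        ((16 : ℕ) : ℤ⟦X⟧) * (1 + eulerQuot) * eulerQuot + eulerQuot ^ 2),
      mul_mem hW (add_mem (add_mem (mul_mem (hn _) (pow_mem hW' _))
        (mul_mem (mul_mem (hn _) hW') hW)) (pow_mem hW _)),
      (1 + eulerQuot) ^ 2 + ((16 : ℕ) : ℤ⟦X⟧) * (1 + eulerQuot) * eulerQuot +
        ((10 : ℕ) : ℤ⟦X⟧) * eulerQuot ^ 2,
      add_mem (add_mem (pow_mem hW' _) (mul_mem (mul_mem (hn _) hW') hW))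
        (mul_mem (hn _) (pow_mem hW _)),
      ((4 : ℕ) : ℤ⟦X⟧) * (1 + eulerQuot) ^ 2 + ((19 : ℕ) : ℤ⟦X⟧) * (1 + eulerQuot) * eulerQuot +
        ((4 : ℕ) : ℤ⟦X⟧) * eulerQuot ^ 2,
      add_mem (add_mem (mul_mem (hn _) (pow_mem hW' _)) (mul_mem (mul_mem (hn _) hW') hW))
        (mul_mem (hn _) (pow_mem hW _)), ?_⟩
    simp only [map_add, map_mul, map_one, map_pow, map_natCast]
    exact h
  | zero => exact ⟨0, _, .intCast 0, by simp⟩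
  | one => exact ⟨1, _, .intCast 0, by simp⟩
  | add x y _ _ hx hy =>
    obtain ⟨c, f, hf, rfl⟩ := hx
    obtain ⟨d, g, hg, rfl⟩ := hy
    exact ⟨c + d, f + g, hf.add hg, by push_cast; ring⟩
  | neg x _ hx =>
    obtain ⟨c, f, hf, rfl⟩ := hx
    exact ⟨-c, -f, hneg f hf, by push_cast; ring⟩
  | mul x y _ _ hx hy =>
    obtain ⟨c, f, hf, rfl⟩ := hx
    obtain ⟨d, g, hg, rfl⟩ := hy
    refine ⟨c * d, (c * g + d * f) + ((9 : ℤ) : ℤ⟦X⟧) * (f * g), ((((IsDissected.intCast c).mul hg).add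
      ((IsDissected.intCast d).mul hf))).add ((IsDissected.intCast 9).mul (hf.mul hg)), ?_⟩
    push_cast
    ring

theorem natCast_mul_pow_mul_pow_mem (n i j : ℕ) :
    (n : ℤ⟦X⟧) * (1 + eulerQuot) ^ i * eulerQuot ^ j ∈ quotRing :=
  mul_mem (mul_mem (natCast_mem _ n) (pow_mem (add_mem (one_mem _) eulerQuot_mem) i))
    (pow_mem eulerQuot_mem j)

theorem exists_trinomial_pow_four :
    ∃ H₀ ∈ quotRing, ∃ H₁ ∈ quotRing, ∃ H₂ ∈ quotRing,
      (cubeMain ^ 2 + cubeMain * cubeTail + cubeTail ^ 2) ^ 4 * expandThree ℤ normInv ^ 2 =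
        cubeTail ^ 2 * expandThree ℤ H₀ + cubeMain * cubeTail * expandThree ℤ H₁ +
          cubeMain ^ 2 * expandThree ℤ H₂ := by
  have hm := natCast_mul_pow_mul_pow_mem
  refine ⟨_, add_mem (add_mem (hm 10 2 0) (hm 16 1 1)) (hm 1 0 2),
    _, add_mem (add_mem (hm 4 2 0) (hm 19 1 1)) (hm 4 0 2),
    _, add_mem (add_mem (hm 1 2 0) (hm 16 1 1)) (hm 10 0 2), ?_⟩
  rw [trinomial_pow_four cubeMain_cube cubeTail_cube expandThree_norm_mul]
  simp only [map_add, map_mul, map_one, map_pow, map_ofNat, Nat.cast_ofNat, Nat.cast_one, pow_zero,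
    pow_one, one_mul, mul_one]

theorem exists_trinomial_pow_six :
    ∃ H₀ ∈ quotRing, ∃ H₁ ∈ quotRing, ∃ H₂ ∈ quotRing,
      (cubeMain ^ 2 + cubeMain * cubeTail + cubeTail ^ 2) ^ 6 * expandThree ℤ normInv ^ 4 =
        expandThree ℤ H₀ +
        expandThree ℤ normInv * cubeMain ^ 2 * cubeTail * expandThree ℤ (((3 : ℕ) : ℤ⟦X⟧) * H₁) +
        expandThree ℤ normInv * cubeMain * cubeTail ^ 2 *
          expandThree ℤ (((3 : ℕ) : ℤ⟦X⟧) * H₂) := by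
  have hm := natCast_mul_pow_mul_pow_mem
  refine ⟨_, add_mem (add_mem (add_mem (add_mem (hm 1 4 0) (hm 50 3 1)) (hm 141 2 2)) (hm 50 1 3))
      (hm 1 0 4),
    _, add_mem (add_mem (add_mem (hm 2 3 0) (hm 30 2 1)) (hm 42 1 2)) (hm 7 0 3),
    _, add_mem (add_mem (add_mem (hm 7 3 0) (hm 42 2 1)) (hm 30 1 2)) (hm 2 0 3), ?_⟩
  rw [trinomial_pow_six cubeMain_cube cubeTail_cube expandThree_norm_mul]
  simp only [map_add, map_mul, map_one, map_pow, map_ofNat, Nat.cast_ofNat, Nat.cast_one, pow_zero,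
    pow_one, one_mul, mul_one]

/-! ### The two alternating dissections and the initial one -/

/-- The 3-dissection of `E_3^6 / E_1^12 · F(W)`. -/
theorem dissection_oddLevel {F : ℤ⟦X⟧} (hF : F ∈ quotRing) :
    ∃ a b, ∃ G ∈ quotRing, eulerE 3 ^ 6 * eulerInv 1 ^ 12 * F =
      expandThree ℤ a + X * expandThree ℤ (3 * b) +
        X ^ 2 * expandThree ℤ (9 * (eulerE 3 ^ 12 * eulerInv 1 ^ 18 * G)) := by
  obtain ⟨c, f, hf, rfl⟩ := exists_eq_intCast_add_nine_mul hF
  obtain ⟨G₀, hG₀, G₁, hG₁, G₂, hG₂, hG⟩ :=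
    (IsDissected.intCast c).add ((IsDissected.intCast 9).mul hf)
  rw [Int.cast_ofNat] at hG
  rw [hG, show eulerInv 1 ^ 12 = (eulerInv 1 ^ 3) ^ 4 by ring, eulerInv_one_cube]
  have hW := eulerQuot_mem
  have hW' := add_mem (one_mem quotRing) hW
  obtain ⟨H₀, hH₀m, H₁, hH₁m, H₂, hH₂m, hQ⟩ := exists_trinomial_pow_four
  -- Of the four factors `1/z` in `1/E_1^12`, two normalise the trinomial power; the other two join
  -- `E_3^6` to form a series in `q^3`.
  have hpre : eulerE 3 ^ 6 * expandThree ℤ normInv ^ 2 =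
      expandThree ℤ (eulerInv 1 ^ 18 * eulerE 3 ^ 6) := by
    have h₁ : eulerE 1 ^ 6 * eulerInv 1 ^ 6 = 1 := by
      rw [← mul_pow, eulerE_mul_eulerInv le_rfl, one_pow]
    have h₂ : eulerE 1 ^ 6 * normInv ^ 2 = eulerInv 1 ^ 18 * eulerE 3 ^ 6 := by
      rw [normInv]
      linear_combination eulerInv 1 ^ 18 * eulerE 3 ^ 6 * h₁
    rw [← h₂, map_mul, map_pow, map_pow, expandThree_eulerE le_rfl]
  -- The witnesses are the coefficients of `A^2`, `A t` and `t^2` in `hprod` below; substituting `t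
  -- = 3 q E_9^3` supplies the 3 and the 9.
  refine ⟨eulerInv 1 ^ 18 * eulerE 3 ^ 6 * eulerCubePart ^ 2 *
      (G₀ * H₂ + eulerQuot * G₁ * H₀ + eulerQuot * G₂ * H₁),
    eulerInv 1 ^ 18 * eulerE 3 ^ 9 * eulerCubePart * (G₀ * H₁ + (1 + eulerQuot) * G₁ * H₂ + eulerQuot * G₂ * H₀),
    G₀ * H₀ + (1 + eulerQuot) * (G₁ * H₁ + G₂ * H₂),
    add_mem (mul_mem hG₀ hH₀m) (mul_mem hW' (add_mem (mul_mem hG₁ hH₁m) (mul_mem hG₂ hH₂m))), ?_⟩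
  have hA := cubeMain_cube
  have ht := cubeTail_cube
  have hZ := expandThree_norm_mul
  have hT : cubeTail = 3 * X * expandThree ℤ (eulerE 3) ^ 3 := by rw [cubeTail, map_pow]
  simp only [map_add, map_mul, map_one, map_pow, map_ofNat] at hpre ⊢
  rw [show expandThree ℤ eulerCubePart = cubeMain from rfl]
  generalize expandThree ℤ (eulerE 1 ^ 12 * eulerInv 3 ^ 3) = Z at hA ht hZ
  generalize expandThree ℤ normInv = Z' at *
  generalize expandThree ℤ eulerQuot = w at *
  generalize cubeMain = A at *
  generalize expandThree ℤ G₀ = g₀ at *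
  generalize expandThree ℤ G₁ = g₁ at *
  generalize expandThree ℤ G₂ = g₂ at *
  generalize expandThree ℤ H₀ = h₀ at *
  generalize expandThree ℤ H₁ = h₁ at *
  generalize expandThree ℤ H₂ = h₂ at *
  generalize expandThree ℤ (eulerE 3) = e at *
  generalize expandThree ℤ (eulerInv 1) = i at *
  generalize cubeTail = t at *
  have hA' : Z' * A ^ 3 = 1 + w := by linear_combination Z' * hA + (1 + w) * hZ
  have ht' : Z' * t ^ 3 = w := by linear_combination Z' * ht + w * hZ
  have hprod : (t ^ 2 * h₀ + A * t * h₁ + A ^ 2 * h₂) *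
      (g₀ + Z' * A ^ 2 * t * g₁ + Z' * A * t ^ 2 * g₂) =
      A ^ 2 * (g₀ * h₂ + w * g₁ * h₀ + w * g₂ * h₁) +
      t * (A * (g₀ * h₁ + (1 + w) * g₁ * h₂ + w * g₂ * h₀)) +
      t ^ 2 * (g₀ * h₀ + (1 + w) * (g₁ * h₁ + g₂ * h₂)) := by
    linear_combination (t * A * g₁ * h₂ + t ^ 2 * (g₁ * h₁ + g₂ * h₂)) * hA' +
      (A ^ 2 * (g₁ * h₀ + g₂ * h₁) + A * t * g₂ * h₀) * ht'
  calc _ = (eulerE 3 ^ 6 * Z' ^ 2) * (((A ^ 2 + A * t + t ^ 2) ^ 4 * Z' ^ 2) *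
        (g₀ + Z' * A ^ 2 * t * g₁ + Z' * A * t ^ 2 * g₂)) := by ring
    _ = _ := by
      rw [hQ, hpre, hprod, hT]
      ring

/-- The 3-dissection of `E_3^12 / E_1^18 · F(W)`. -/
theorem dissection_evenLevel {F : ℤ⟦X⟧} (hF : F ∈ quotRing) :
    ∃ G ∈ quotRing, ∃ b c, eulerE 3 ^ 12 * eulerInv 1 ^ 18 * F =
      expandThree ℤ (eulerE 3 ^ 6 * eulerInv 1 ^ 12 * G) + X * expandThree ℤ (9 * b) +
        X ^ 2 * expandThree ℤ (27 * c) := by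
  obtain ⟨m, f, hf, rfl⟩ := exists_eq_intCast_add_nine_mul hF
  rw [show eulerInv 1 ^ 18 = (eulerInv 1 ^ 3) ^ 6 by ring, eulerInv_one_cube]
  have hn : ∀ n : ℕ, (n : ℤ⟦X⟧) ∈ quotRing := natCast_mem _
  obtain ⟨H₀, hH₀m, H₁, hH₁m, H₂, hH₂m, hQ⟩ := exists_trinomial_pow_six
  obtain ⟨G₀, hG₀, G₁, hG₁, G₂, hG₂, hG⟩ := IsDissected.mul
    ⟨_, hH₀m, _, mul_mem (hn 3) hH₁m, _, mul_mem (hn 3) hH₂m, hQ⟩ hf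
  have hpre : eulerE 3 ^ 12 * expandThree ℤ normInv ^ 2 =
      expandThree ℤ (eulerE 3 ^ 6 * eulerInv 1 ^ 12) := by
    have h₁ : eulerE 1 ^ 12 * eulerInv 1 ^ 12 = 1 := by
      rw [← mul_pow, eulerE_mul_eulerInv le_rfl, one_pow]
    have h₂ : eulerE 1 ^ 12 * normInv ^ 2 = eulerE 3 ^ 6 * eulerInv 1 ^ 12 := by
      rw [normInv]
      linear_combination eulerInv 1 ^ 12 * eulerE 3 ^ 6 * h₁
    rw [← h₂, map_mul, map_pow, map_pow, expandThree_eulerE le_rfl]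
  refine ⟨m * H₀ + ((9 : ℕ) : ℤ⟦X⟧) * G₀,
    add_mem (mul_mem (intCast_mem _ m) hH₀m) (mul_mem (hn 9) hG₀),
    eulerE 3 ^ 9 * eulerInv 1 ^ 12 * normInv * eulerCubePart ^ 2 * (m * H₁ + 3 * G₁),
    eulerE 3 ^ 12 * eulerInv 1 ^ 12 * normInv * eulerCubePart * (m * H₂ + 3 * G₂), ?_⟩
  have hT : cubeTail = 3 * X * expandThree ℤ (eulerE 3) ^ 3 := by rw [cubeTail, map_pow]
  simp only [map_add, map_mul, map_pow, map_ofNat, map_intCast,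
    Nat.cast_ofNat] at hpre hQ ⊢
  rw [show expandThree ℤ eulerCubePart = cubeMain from rfl]
  -- The constant `m` meets the sixth power, whose `α` and `β` parts carry a 3; the rest carries a
  -- 9. With the 3 from `t` and the 9 from `t^2`, residues 1 and 2 gain 9 and 27.
  calc _ = (eulerE 3 ^ 12 * expandThree ℤ normInv ^ 2) *
        (m * ((cubeMain ^ 2 + cubeMain * cubeTail + cubeTail ^ 2) ^ 6 *
          expandThree ℤ normInv ^ 4) +
        9 * ((cubeMain ^ 2 + cubeMain * cubeTail + cubeTail ^ 2) ^ 6 *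
          expandThree ℤ normInv ^ 4 * f)) := by ring
    _ = _ := by
      rw [hG, hQ, hpre, hT]
      ring

/-- The 3-dissection of `1 / (E_1^3 E_9^3)`. -/
theorem dissection_partitionTriple :
    ∃ a b, PowerSeries.mk (partitionTriple 9) = expandThree ℤ a + X * expandThree ℤ b +
      X ^ 2 * expandThree ℤ (9 * (eulerE 3 ^ 6 * eulerInv 1 ^ 12)) := by
  have h₁ : eulerE 1 ^ 3 * eulerInv 1 ^ 3 = 1 := by
    rw [← mul_pow, eulerE_mul_eulerInv le_rfl, one_pow]
  have h₉ : eulerE 9 ^ 3 * eulerInv 9 ^ 3 = 1 := by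
    rw [← mul_pow, eulerE_mul_eulerInv (by norm_num), one_pow]
  have hp : PowerSeries.mk (partitionTriple 9) = eulerInv 1 ^ 3 * eulerInv 9 ^ 3 := by
    refine left_inv_eq_right_inv (partitionTriple_genFun (by norm_num)) ?_
    linear_combination eulerE 9 ^ 3 * eulerInv 9 ^ 3 * h₁ + h₉
  have h₃ : expandThree ℤ (eulerE 3) ^ 3 * eulerInv 9 ^ 3 = 1 := by
    rw [expandThree_eulerE (by norm_num)]
    exact h₉
  have hT : cubeTail = 3 * X * expandThree ℤ (eulerE 3) ^ 3 := by rw [cubeTail, map_pow]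
  have hN : expandThree ℤ normInv = expandThree ℤ (eulerE 3) ^ 3 * expandThree ℤ (eulerInv 1) ^ 12 := by
    simp only [normInv, map_mul, map_pow]
  refine ⟨eulerInv 1 ^ 12 * eulerCubePart ^ 2, 3 * eulerInv 1 ^ 12 * eulerCubePart * eulerE 3 ^ 3, ?_⟩
  rw [hp, eulerInv_one_cube, hN, hT]
  simp only [map_mul, map_pow, map_ofNat]
  rw [show expandThree ℤ eulerCubePart = cubeMain from rfl]
  linear_combination ((cubeMain ^ 2 + 3 * X * cubeMain * expandThree ℤ (eulerE 3) ^ 3 +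
    9 * X ^ 2 * expandThree ℤ (eulerE 3) ^ 6) * expandThree ℤ (eulerInv 1) ^ 12) * h₃

theorem coeff_ofNat_mul (r n : ℕ) [r.AtLeastTwo] (f : ℤ⟦X⟧) :
    coeff n (OfNat.ofNat r * f) = OfNat.ofNat r * coeff n f := by
  rw [← map_ofNat (C (R := ℤ)) r, coeff_C_mul]

/-! ### Induction on the level -/

/-- The coefficients along `3^(2β+1) n + (3^(2β+1) + 5)/4`. -/
def OddLevel (β : ℕ) : Prop :=
  ∃ F ∈ quotRing, ∀ n, partitionTriple 9 (3 ^ (2 * β + 1) * n + (3 ^ (2 * β + 1) + 5) / 4) =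
    3 ^ (2 * β + 2) * coeff n (eulerE 3 ^ 6 * eulerInv 1 ^ 12 * F)

/-- The coefficients along `3^(2β+2) n + (3^(2β+3) + 5)/4`. -/
def EvenLevel (β : ℕ) : Prop :=
  ∃ F ∈ quotRing, ∀ n, partitionTriple 9 (3 ^ (2 * β + 2) * n + (3 ^ (2 * β + 3) + 5) / 4) =
    3 ^ (2 * β + 4) * coeff n (eulerE 3 ^ 12 * eulerInv 1 ^ 18 * F)

theorem oddLevel_zero : OddLevel 0 := by
  refine ⟨1, one_mem _, fun n => ?_⟩
  obtain ⟨a, b, h⟩ := dissection_partitionTriple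
  have h' := congrArg (coeff (3 * n + 2)) h
  rw [coeff_mk, coeff_dissection_two, coeff_ofNat_mul] at h'
  simpa using h'

theorem pow_three_odd_mod_four (β : ℕ) : 3 ^ (2 * β + 1) % 4 = 3 := by
  rw [pow_succ, pow_mul, Nat.mul_mod, Nat.pow_mod]
  simp

theorem OddLevel.dissection {β : ℕ} (h : OddLevel β) :
    (∀ n, (3 : ℤ) ^ (2 * β + 3) ∣
      partitionTriple 9 (3 ^ (2 * β + 2) * n + (5 * 3 ^ (2 * β + 1) + 5) / 4)) ∧ EvenLevel β := by
  obtain ⟨F, hF, h⟩ := h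
  obtain ⟨a, b, G, hG, hd⟩ := dissection_oddLevel hF
  -- With `r = 3^(2β+1)`, `r ≡ 3 (mod 4)` makes the divisions by 4 exact; adding `r` or `2r` to `(r
  -- + 5)/4` gives `(5r + 5)/4` or `(9r + 5)/4`.
  have hm := pow_three_odd_mod_four β
  have e₃ : 3 ^ (2 * β + 3) = 9 * 3 ^ (2 * β + 1) := by ring
  have e : ∀ n, 3 ^ (2 * β + 2) * n = 3 ^ (2 * β + 1) * (3 * n) := fun n => by ring
  refine ⟨fun n => ?_, G, hG, fun n => ?_⟩
  · have h₁ := h (3 * n + 1)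
    rw [hd, coeff_dissection_one, coeff_ofNat_mul] at h₁
    rw [show 3 ^ (2 * β + 2) * n + (5 * 3 ^ (2 * β + 1) + 5) / 4 =
      3 ^ (2 * β + 1) * (3 * n + 1) + (3 ^ (2 * β + 1) + 5) / 4 by rw [mul_add, e]; omega, h₁]
    exact ⟨coeff n b, by ring⟩
  · have h₂ := h (3 * n + 2)
    rw [hd, coeff_dissection_two, coeff_ofNat_mul] at h₂
    rw [show 3 ^ (2 * β + 2) * n + (3 ^ (2 * β + 3) + 5) / 4 =
      3 ^ (2 * β + 1) * (3 * n + 2) + (3 ^ (2 * β + 1) + 5) / 4 by rw [mul_add, e]; omega, h₂]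
    ring

theorem EvenLevel.dissection {β : ℕ} (h : EvenLevel β) :
    OddLevel (β + 1) ∧ (∀ n, (3 : ℤ) ^ (2 * β + 6) ∣
      partitionTriple 9 (3 ^ (2 * β + 3) * n + (7 * 3 ^ (2 * β + 2) + 5) / 4)) ∧
    ∀ n, (3 : ℤ) ^ (2 * β + 7) ∣
      partitionTriple 9 (3 ^ (2 * β + 3) * n + (11 * 3 ^ (2 * β + 2) + 5) / 4) := by
  obtain ⟨F, hF, h⟩ := h
  obtain ⟨G, hG, b, c, hd⟩ := dissection_evenLevel hF
  -- With `s = 3^(2β+2)`, the offset `(3s + 5)/4` is kept for residue 0 and becomes `(7s + 5)/4` or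
  -- `(11s + 5)/4` for residues 1 and 2.
  have hm := pow_three_odd_mod_four (β + 1)
  rw [show 2 * (β + 1) + 1 = 2 * β + 3 by ring] at hm
  have e₃ : 3 ^ (2 * β + 3) = 3 * 3 ^ (2 * β + 2) := by ring
  have e : ∀ n, 3 ^ (2 * β + 3) * n = 3 ^ (2 * β + 2) * (3 * n) := fun n => by ring
  refine ⟨⟨G, hG, fun n => ?_⟩, fun n => ?_, fun n => ?_⟩
  · have h₀ := h (3 * n)
    rw [hd, coeff_dissection_zero] at h₀
    rw [show 2 * (β + 1) + 1 = 2 * β + 3 by ring, show 2 * (β + 1) + 2 = 2 * β + 4 by ring, e, h₀]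
  · have h₁ := h (3 * n + 1)
    rw [hd, coeff_dissection_one, coeff_ofNat_mul] at h₁
    rw [show 3 ^ (2 * β + 3) * n + (7 * 3 ^ (2 * β + 2) + 5) / 4 =
      3 ^ (2 * β + 2) * (3 * n + 1) + (3 ^ (2 * β + 3) + 5) / 4 by rw [mul_add, e]; omega, h₁]
    exact ⟨coeff n b, by ring⟩
  · have h₂ := h (3 * n + 2)
    rw [hd, coeff_dissection_two, coeff_ofNat_mul] at h₂
    rw [show 3 ^ (2 * β + 3) * n + (11 * 3 ^ (2 * β + 2) + 5) / 4 =
      3 ^ (2 * β + 2) * (3 * n + 2) + (3 ^ (2 * β + 3) + 5) / 4 by rw [mul_add, e]; omega, h₂]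
    exact ⟨coeff n c, by ring⟩

theorem oddLevel (β : ℕ) : OddLevel β := by
  induction β with
  | zero => exact oddLevel_zero
  | succ β ih => exact ih.dissection.2.dissection.1

theorem theorem3 (n α : ℕ) (hα : 1 ≤ α) :
    partitionTriple 9 (3 ^ (2 * α - 1) * n + (3 ^ (2 * α - 1) + 5) / 4)
        ≡ 0 [ZMOD 3 ^ (2 * α)] ∧
    partitionTriple 9 (3 ^ (2 * α + 1) * n + (7 * 3 ^ (2 * α) + 5) / 4)
        ≡ 0 [ZMOD 3 ^ (2 * α + 4)] ∧
    partitionTriple 9 (3 ^ (2 * α + 1) * n + (11 * 3 ^ (2 * α) + 5) / 4)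
        ≡ 0 [ZMOD 3 ^ (2 * α + 5)] ∧
    partitionTriple 9 (3 ^ (2 * α) * n + (5 * 3 ^ (2 * α - 1) + 5) / 4)
        ≡ 0 [ZMOD 3 ^ (2 * α + 1)] ∧
    partitionTriple 9 (3 ^ (2 * α) * n + (3 ^ (2 * α + 1) + 5) / 4)
        ≡ 0 [ZMOD 3 ^ (2 * α + 2)] := by
  -- With `α = β + 1` the exponents, including `2α - 1`, reduce definitionally to those of the level
  -- statements.
  obtain ⟨β, rfl⟩ := Nat.exists_eq_add_of_le' hα
  have hodd := oddLevel β
  obtain ⟨h₄, heven⟩ := hodd.dissection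
  obtain ⟨-, h₂, h₃⟩ := heven.dissection
  obtain ⟨F, -, hF⟩ := hodd
  obtain ⟨G, -, hG⟩ := heven
  simp only [Int.modEq_zero_iff_dvd]
  exact ⟨⟨_, hF n⟩, h₂ n, h₃ n, h₄ n, ⟨_, hG n⟩⟩
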